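/- Let $n \ge 5$. For $j = 1,\dots,n$ let $I_j = (j, j+1, \dots, j+n-3)$, indices being taken modulo $n$ in $\{1,\dots,n\}$. Let ${\bf u} = \{u^1,\dots,u^n\} \subset \mathbb R^n_+$ be nonnegative vectors such that the set of indices of positive entries of $u^j$ is $I_j$ for every $j$, and put $c^t = (c^t_0,\dots,c^t_{n-3}) = u^t_{I_t}$ for $t = 1,\dots,n$ and $c^{t+n} = c^t$ for all $t \ge 1$. Let ${\cal S}^n$ be the space of real symmetric $n \times n$ matrices, ${\cal S}^n_+$ the cone of positive semi-definite ones, ${\cal N}^n$ the cone of element-wise nonnegative ones, and ${\cal C}^n = \{A \in {\cal S}^n \mid x^TAx \ge 0\ \forall\, x \in \mathbb R^n_+\}$ the copositive cone; a matrix in ${\cal C}^n \setminus ({\cal S}^n_+ + {\cal N}^n)$ is called exceptional. Define $$F_{\bf u} = \{A \in {\cal C}^n \mid (u^j)^TAu^j = 0\ \forall j\}, \qquad P_{\bf u} = \{A \in {\cal S}^n_+ \mid (u^j)^TAu^j = 0\ \forall j\}.$$ Let ${\cal L}_{\bf u}$ be the space of real sequences $x = (x_t)_{t\ge 1}$ with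 $\sum_{i=0}^{n-3} c^t_i x_{t+i} = 0$ for all $t \ge 1$, let ${\bf e}_t \in {\cal L}_{\bf u}^*$ be the evaluation functional $x \mapsto x_t$, let ${\mathfrak M} : {\cal L}_{\bf u} \to {\cal L}_{\bf u}$, $(x_t)_t \mapsto (x_{t+n})_t$, be the monodromy, and ${\mathfrak M}^*$ its adjoint. The functionals ${\bf e}_1,\dots,{\bf e}_{n-3}$ form a basis of ${\cal L}_{\bf u}^*$. Let ${\cal A}_{\bf u} = \{A \in {\cal S}^n \mid A_{I_j}u^j_{I_j} = 0\ \forall j\}$, where $A_{I_j}$ is the principal submatrix of $A$ with index set $I_j$, and let $\Lambda$ be the linear map that takes $A \in {\cal A}_{\bf u}$ to the symmetric bilinear form $B$ on ${\cal L}_{\bf u}^*$ with $B({\bf e}_t,{\bf e}_s) = A_{ts}$ for $t,s = 1,\dots,n-3$. Let ${\cal F}_{\bf u}$ be the set of positive semi-definite symmetric bilinear forms $B$ on ${\cal L}_{\bf u}^*$ satisfying the linear equalities $$B({\bf e}_t,{\bf e}_s) = B({\mathfrak M}^*{\bf e}_t,{\mathfrak M}^*{\bf e}_s), \quad t,s =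 1,\dots,n-3;$$ $$B({\bf e}_t,{\bf e}_s) = B({\mathfrak M}^*{\bf e}_t,{\bf e}_s), \quad 1 \le t < s \le n,\ 3 \le s-t \le n-3;$$ and the linear inequalities $$B({\bf e}_t,{\bf e}_{t+2}) \ge B({\mathfrak M}^*{\bf e}_t,{\bf e}_{t+2}), \quad t = 1,\dots,n,$$ and let ${\cal P}_{\bf u} \subset {\cal F}_{\bf u}$ be the subset of forms satisfying all these inequalities with equality. Then $\Lambda$ is injective, its image contains ${\cal F}_{\bf u}$, and $$F_{\bf u} = \Lambda^{-1}[{\cal F}_{\bf u}], \qquad P_{\bf u} = \Lambda^{-1}[{\cal P}_{\bf u}].$$ Moreover, for every $B \in {\cal F}_{\bf u} \setminus {\cal P}_{\bf u}$ all $n$ linear inequalities are strict, and every matrix in $F_{\bf u} \setminus P_{\bf u}$ is exceptional. -/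

import Mathlib

open Matrix

namespace CircCop

/-! ### Copositive matrices -/

/-- `A` belongs to the cone `𝒞ⁿ` of copositive matrices: `A` is symmetric and `xᵀ A x ≥ 0`
for every nonnegative vector `x`. -/
def IsCopositive {n : ℕ} (A : Matrix (Fin n) (Fin n) ℝ) : Prop :=
  A.IsSymm ∧ ∀ x : Fin n → ℝ, (∀ i, 0 ≤ x i) → 0 ≤ x ⬝ᵥ A *ᵥ x

/-- `A` is exceptional: it is copositive, but it is not the sum of a positive semi-definite matrix
and a symmetric element-wise nonnegative matrix. -/
def IsExceptional {n : ℕ} (A : Matrix (Fin n) (Fin n) ℝ) : Prop :=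
  IsCopositive A ∧
    ¬ ∃ P N : Matrix (Fin n) (Fin n) ℝ,
        P.PosSemidef ∧ (N.IsSymm ∧ ∀ i j, 0 ≤ N i j) ∧ A = P + N

/-- The face `F_u` of the copositive cone. -/
def faceF {n : ℕ} (u : Fin n → Fin n → ℝ) : Set (Matrix (Fin n) (Fin n) ℝ) :=
  {A | IsCopositive A ∧ ∀ j, u j ⬝ᵥ A *ᵥ u j = 0}

/-- The face `P_u` of the positive semi-definite cone. -/
def faceP {n : ℕ} (u : Fin n → Fin n → ℝ) : Set (Matrix (Fin n) (Fin n) ℝ) :=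
  {A | A.PosSemidef ∧ ∀ j, u j ⬝ᵥ A *ᵥ u j = 0}

/-! ### Linear systems with periodic coefficients

Time starts at `0`: the index `t` here is the time instant `t + 1` of a system whose time starts
at `1`. -/

/-- The space of solutions `x = (x_t)` of the system `∑_{i=0}^d c^t_i x_{t+i} = 0` for all `t`. -/
def solutions (d : ℕ) (c : ℕ → ℕ → ℝ) : Submodule ℝ (ℕ → ℝ) where
  carrier := {x | ∀ t, ∑ i ∈ Finset.range (d + 1), c t i * x (t + i) = 0}
  add_mem' := by
    intro x y hx hy t
    simp only [Pi.add_apply, mul_add, Finset.sum_add_distrib, hx t, hy t, add_zero]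
  zero_mem' := by
    intro t
    simp
  smul_mem' := by
    intro r x hx t
    simp only [Pi.smul_apply, smul_eq_mul, mul_left_comm _ r, ← Finset.mul_sum, hx t, mul_zero]

/-- The evaluation functional `e_t : x ↦ x_t` on the solution space. -/
def ev {d : ℕ} {c : ℕ → ℕ → ℝ} (t : ℕ) : Module.Dual ℝ (solutions d c) :=
  (LinearMap.proj t).comp (solutions d c).subtype

@[simp]
theorem ev_apply {d : ℕ} {c : ℕ → ℕ → ℝ} (t : ℕ) (x : solutions d c) :
    ev t x = (x : ℕ → ℝ) t := rfl

/-- The monodromy `(x_t) ↦ (x_{t+n})` of a system with `n`-periodic coefficients. -/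
def monodromy {d n : ℕ} {c : ℕ → ℕ → ℝ} (hc : ∀ t, c (t + n) = c t) :
    solutions d c →ₗ[ℝ] solutions d c where
  toFun x := ⟨fun t => (x : ℕ → ℝ) (t + n), by
    intro t
    have h := x.2 (t + n)
    rw [hc t] at h
    simpa only [add_right_comm t n] using h⟩
  map_add' _ _ := rfl
  map_smul' _ _ := rfl

/-- The solution with initial values `v 0, …, v (d-1)`. -/
noncomputable def solutionFrom (d : ℕ) (c : ℕ → ℕ → ℝ) (v : ℕ → ℝ) : ℕ → ℝ
  | t => if _h : t < d then v t else
      -(∑ i : Fin d, c (t - d) i * solutionFrom d c v (t - d + i)) / c (t - d) d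
  termination_by t => t
  decreasing_by omega

theorem solutionFrom_init (d : ℕ) (c : ℕ → ℕ → ℝ) (v : ℕ → ℝ) {t : ℕ} (ht : t < d) :
    solutionFrom d c v t = v t := by
  rw [solutionFrom, dif_pos ht]

theorem solutionFrom_mem (d : ℕ) (c : ℕ → ℕ → ℝ) (hc : ∀ t, c t d ≠ 0) (v : ℕ → ℝ) :
    solutionFrom d c v ∈ solutions d c := by
  intro t
  rw [Finset.sum_range_succ, solutionFrom.eq_1 d c v (t + d), dif_neg (by omega),
    Nat.add_sub_cancel, Finset.sum_range (fun i => c t i * solutionFrom d c v (t + i)),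
    mul_div_cancel₀ _ (hc t)]
  ring

theorem solution_eq_zero {d : ℕ} {c : ℕ → ℕ → ℝ} (hc : ∀ t, c t d ≠ 0) (x : solutions d c)
    (hx : ∀ t < d, (x : ℕ → ℝ) t = 0) (t : ℕ) : (x : ℕ → ℝ) t = 0 := by
  induction t using Nat.strong_induction_on with
  | _ t ih =>
    by_cases ht : t < d
    · exact hx t ht
    · have h := x.2 (t - d)
      rw [Finset.sum_range_succ, Finset.sum_eq_zero, zero_add, Nat.sub_add_cancel (by omega)] at h
      · exact (mul_eq_zero.mp h).resolve_left (hc _)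
      · intro i hi
        rw [Finset.mem_range] at hi
        rw [ih _ (by omega), mul_zero]

/-- A solution is determined by its initial values `(x_0, …, x_{d-1})`, which are arbitrary. -/
noncomputable def initEquiv {d : ℕ} {c : ℕ → ℕ → ℝ} (hc : ∀ t, c t d ≠ 0) :
    solutions d c ≃ₗ[ℝ] (Fin d → ℝ) :=
  LinearEquiv.ofBijective
    (LinearMap.pi fun i : Fin d => (ev (i : ℕ) : Module.Dual ℝ (solutions d c)))
    ⟨by
      rw [← LinearMap.ker_eq_bot, LinearMap.ker_eq_bot']
      intro x hx
      ext t
      exact solution_eq_zero hc x (fun s hs => congrFun hx ⟨s, hs⟩) t,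
    by
      intro v
      refine ⟨⟨solutionFrom d c (fun t => if h : t < d then v ⟨t, h⟩ else 0),
        solutionFrom_mem d c hc _⟩, ?_⟩
      funext i
      change solutionFrom d c _ (i : ℕ) = v i
      rw [solutionFrom_init d c _ i.2, dif_pos i.2]⟩

/-- The basis `e_0, …, e_{d-1}` of the dual of the solution space. -/
noncomputable def evBasis {d : ℕ} {c : ℕ → ℕ → ℝ} (hc : ∀ t, c t d ≠ 0) :
    Module.Basis (Fin d) ℝ (Module.Dual ℝ (solutions d c)) :=
  (Module.Basis.ofEquivFun (initEquiv hc)).dualBasis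

theorem evBasis_apply {d : ℕ} {c : ℕ → ℕ → ℝ} (hc : ∀ t, c t d ≠ 0) (i : Fin d) :
    evBasis hc i = ev (i : ℕ) := by
  ext x
  rw [evBasis, Module.Basis.dualBasis_apply, Module.Basis.ofEquivFun_repr_apply]
  rfl

/-! ### The system attached to the zeros -/

/-- The residue of `t` modulo `n`, as an index of a row or column. -/
def cyc (n : ℕ) [NeZero n] (t : ℕ) : Fin n := Fin.ofNat n t

/-- The ordered index set `I_j = (j, j+1, …, j+n-3)`, taken modulo `n`. -/
def idx (n : ℕ) [NeZero n] (j : Fin n) (i : Fin (n - 2)) : Fin n := cyc n ((j : ℕ) + i)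

/-- The vectors `u^j` are nonnegative, and the set of indices of positive entries of `u^j`
is `I_j`. -/
def HasCirculantSupports {n : ℕ} [NeZero n] (u : Fin n → Fin n → ℝ) : Prop :=
  ∀ j, (∀ i, 0 ≤ u j i) ∧ {i | 0 < u j i} = Set.range (idx n j)

/-- The coefficients of the system `S_u`: the vector `(c^t_i)_{0 ≤ i ≤ n-3}` is `u^t_{I_t}`,
with `t` modulo `n`. -/
def coeff {n : ℕ} [NeZero n] (u : Fin n → Fin n → ℝ) (t i : ℕ) : ℝ :=
  u (cyc n t) (cyc n (t + i))

theorem cyc_add_period (n : ℕ) [NeZero n] (t : ℕ) : cyc n (t + n) = cyc n t := by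
  apply Fin.ext
  simp [cyc]

theorem coeff_periodic {n : ℕ} [NeZero n] (u : Fin n → Fin n → ℝ) (t : ℕ) :
    coeff u (t + n) = coeff u t := by
  funext i
  rw [coeff, coeff, cyc_add_period, add_right_comm, cyc_add_period]

theorem coeff_ne_zero {n : ℕ} [NeZero n] (hn : 5 ≤ n) {u : Fin n → Fin n → ℝ}
    (hu : HasCirculantSupports u) (t : ℕ) : coeff u t (n - 3) ≠ 0 := by
  have h : cyc n (t + (n - 3)) ∈ {i | 0 < u (cyc n t) i} := by
    rw [(hu (cyc n t)).2]
    refine ⟨⟨n - 3, by omega⟩, ?_⟩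
    apply Fin.ext
    simp [idx, cyc]
  exact ne_of_gt h

/-- The solution space `L_u` of the system `S_u` of order `n - 3`. -/
abbrev solSpace {n : ℕ} [NeZero n] (u : Fin n → Fin n → ℝ) : Submodule ℝ (ℕ → ℝ) :=
  solutions (n - 3) (coeff u)

/-- The adjoint `𝔐* : L_u* → L_u*` of the monodromy of `S_u`. -/
def monodromyAdj {n : ℕ} [NeZero n] (u : Fin n → Fin n → ℝ) :
    Module.Dual ℝ (solSpace u) →ₗ[ℝ] Module.Dual ℝ (solSpace u) :=
  (monodromy (d := n - 3) (coeff_periodic u)).dualMap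

theorem monodromyAdj_ev {n : ℕ} [NeZero n] (u : Fin n → Fin n → ℝ) (t : ℕ) :
    monodromyAdj u (ev t) = ev (t + n) := rfl

/-! ### The map `Λ` -/

/-- The space `𝒜_u` of symmetric matrices `A` with `A_{I_j} u^j_{I_j} = 0` for all `j`. -/
def spaceA {n : ℕ} [NeZero n] (u : Fin n → Fin n → ℝ) :
    Submodule ℝ (Matrix (Fin n) (Fin n) ℝ) where
  carrier := {A | A.IsSymm ∧
    ∀ j, A.submatrix (idx n j) (idx n j) *ᵥ (u j ∘ idx n j) = 0}
  add_mem' := by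
    rintro A B ⟨hA, hA'⟩ ⟨hB, hB'⟩
    refine ⟨hA.add hB, fun j => ?_⟩
    rw [Matrix.submatrix_add, Pi.add_apply, Pi.add_apply, Matrix.add_mulVec, hA' j, hB' j,
      add_zero]
  zero_mem' := by
    refine ⟨Matrix.isSymm_zero, fun j => ?_⟩
    rw [Matrix.submatrix_zero, Pi.zero_apply, Pi.zero_apply, Matrix.zero_mulVec]
  smul_mem' := by
    rintro r A ⟨hA, hA'⟩
    refine ⟨hA.smul r, fun j => ?_⟩
    rw [Matrix.submatrix_smul, Pi.smul_apply, Pi.smul_apply, Matrix.smul_mulVec, hA' j, smul_zero]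

/-- The linear map `Λ` taking `A ∈ 𝒜_u` to the bilinear form `B` on `L_u*` with
`B(e_t, e_s) = A_{ts}` on the basis `e_0, …, e_{n-4}`. -/
noncomputable def Lam {n : ℕ} [NeZero n] (hn : 5 ≤ n) {u : Fin n → Fin n → ℝ}
    (hu : HasCirculantSupports u) :
    spaceA u →ₗ[ℝ] LinearMap.BilinForm ℝ (Module.Dual ℝ (solSpace u)) where
  toFun A := Matrix.toBilin (evBasis (coeff_ne_zero hn hu))
    ((A : Matrix (Fin n) (Fin n) ℝ).submatrix (Fin.castLE (Nat.sub_le n 3))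
      (Fin.castLE (Nat.sub_le n 3)))
  map_add' A B := by
    rw [← map_add]
    rfl
  map_smul' r A := by
    rw [RingHom.id_apply, ← map_smul]
    rfl

theorem Lam_ev {n : ℕ} [NeZero n] (hn : 5 ≤ n) {u : Fin n → Fin n → ℝ}
    (hu : HasCirculantSupports u) (A : spaceA u) (t s : Fin (n - 3)) :
    Lam hn hu A (ev t) (ev s) =
      (A : Matrix (Fin n) (Fin n) ℝ) (Fin.castLE (Nat.sub_le n 3) t)
        (Fin.castLE (Nat.sub_le n 3) s) := by
  rw [← evBasis_apply (coeff_ne_zero hn hu), ← evBasis_apply (coeff_ne_zero hn hu)]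
  simp [Lam, Matrix.toBilin_apply, Finsupp.single_apply]

/-! ### The sets of forms -/

/-- The set of positive semi-definite symmetric bilinear forms on `L_u*` cut out by the linear
equalities and inequalities. All time indices are lowered by `1`. -/
def formsF {n : ℕ} [NeZero n] (u : Fin n → Fin n → ℝ) :
    Set (LinearMap.BilinForm ℝ (Module.Dual ℝ (solSpace u))) :=
  {B | B.IsPosSemidef ∧
    (∀ t < n - 3, ∀ s < n - 3,
      B (ev t) (ev s) = B (monodromyAdj u (ev t)) (monodromyAdj u (ev s))) ∧
    (∀ t s, t < s → s < n → 3 ≤ s - t → s - t ≤ n - 3 →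
      B (ev t) (ev s) = B (monodromyAdj u (ev t)) (ev s)) ∧
    ∀ t < n, B (ev t) (ev (t + 2)) ≥ B (monodromyAdj u (ev t)) (ev (t + 2))}

/-- The subset of forms which satisfy all the inequalities with equality. -/
def formsP {n : ℕ} [NeZero n] (u : Fin n → Fin n → ℝ) :
    Set (LinearMap.BilinForm ℝ (Module.Dual ℝ (solSpace u))) :=
  {B | B ∈ formsF u ∧
    ∀ t < n, B (ev t) (ev (t + 2)) = B (monodromyAdj u (ev t)) (ev (t + 2))}

end CircCop

/-!
The first-order conditions at the zeros `u^j` put a copositive `A ∈ F_u` into `𝒜_u` and make every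
`A_{I_j}` positive semi-definite, while `A u^j ≥ 0` at the two indices outside `I_j`. By symmetry of
`A` the `2n` numbers obtained this way are, up to positive factors, only `n` numbers, the slacks.
Conversely, these conditions imply copositivity: subtracting a multiple of a zero from `x ≥ 0` makes
some coordinate of `x` vanish, and a second zero reduces to a vector supported in some `I_j`.

Under `Λ` the entries `A_{ts}` with `t`, `s` in a common window of length `n - 2` become
`B(e_t, e_s)`, because both satisfy the recursion with coefficients `c^t`; the two disagree at
distance `n - 2`, and there the difference is the slack of the corresponding inequality.

If one slack vanishes, then `A` is positive semi-definite on a hyperplane `x_k = 0`. For two zeros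
`y`, `z` that are positive at `k`, the combination `v = z_k y - y_k z` lies in that hyperplane, so
`0 ≤ vᵀ A v = -2 y_k z_k yᵀ A z ≤ 0`. Since any two indices lie in a common `I_j`, this gives
`A z = 0`, so `A` is positive semi-definite and all slacks vanish.
-/

namespace CircCop

section QuadraticForm

variable {ι R : Type*}

theorem exists_sub_smul_nonneg_and_apply_eq_zero [Finite ι] [Field R]
    [LinearOrder R] [IsStrictOrderedRing R] {x z : ι → R} (hx : ∀ i, 0 ≤ x i)
    (hz : ∀ i, 0 ≤ z i) {j : ι} (hj : 0 < z j) :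
    ∃ r : R, 0 ≤ r ∧ (∀ i, 0 ≤ (x - r • z) i) ∧ ∃ k, (x - r • z) k = 0 := by
  obtain ⟨k, hk, hmin⟩ := Set.exists_min_image {i | 0 < z i} (fun i => x i / z i)
    (Set.toFinite _) ⟨j, hj⟩
  rw [Set.mem_ofPred_eq] at hk
  refine ⟨x k / z k, div_nonneg (hx k) hk.le, fun i => ?_, k, by simp [hk.ne']⟩
  simp only [Pi.sub_apply, Pi.smul_apply, smul_eq_mul, sub_nonneg]
  rcases (hz i).eq_or_lt with h | h
  · rw [← h, mul_zero]
    exact hx i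
  · exact (le_div_iff₀ h).1 (hmin i h)

variable [Fintype ι]

theorem dotProduct_mulVec_comm_of_isSymm [CommSemiring R] {A : Matrix ι ι R} (hA : A.IsSymm)
    (x y : ι → R) : x ⬝ᵥ A *ᵥ y = y ⬝ᵥ A *ᵥ x := by
  rw [dotProduct_mulVec, ← mulVec_transpose, hA.eq, dotProduct_comm]

theorem dotProduct_mulVec_add_smul_of_eq_zero [CommRing R] {A : Matrix ι ι R} (hA : A.IsSymm)
    {z : ι → R} (hz : z ⬝ᵥ A *ᵥ z = 0) (x : ι → R) (s : R) :
    (x + s • z) ⬝ᵥ A *ᵥ (x + s • z) = x ⬝ᵥ A *ᵥ x + 2 * s * (x ⬝ᵥ A *ᵥ z) := by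
  simp only [mulVec_add, mulVec_smul, dotProduct_add, add_dotProduct, smul_dotProduct,
    dotProduct_smul, smul_eq_mul, dotProduct_mulVec_comm_of_isSymm hA z x, hz]
  ring

theorem posSemidef_iff_isSymm_and_dotProduct_mulVec_nonneg {A : Matrix ι ι ℝ} :
    A.PosSemidef ↔ A.IsSymm ∧ ∀ x, 0 ≤ x ⬝ᵥ A *ᵥ x := by
  simp only [posSemidef_iff_dotProduct_mulVec, IsHermitian, IsSymm,
    conjTranspose_eq_transpose_of_trivial, star_trivial]

theorem posSemidef_of_mulVec_eq_zero {A : Matrix ι ι ℝ} (hA : A.IsSymm) {k : ι}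
    (hk : ∀ v : ι → ℝ, v k = 0 → 0 ≤ v ⬝ᵥ A *ᵥ v) {z : ι → ℝ} (hzk : z k ≠ 0)
    (hz : A *ᵥ z = 0) : A.PosSemidef := by
  refine posSemidef_iff_isSymm_and_dotProduct_mulVec_nonneg.2 ⟨hA, fun x => ?_⟩
  have hx : x = x - (x k / z k) • z + (x k / z k) • z := (sub_add_cancel _ _).symm
  rw [hx, dotProduct_mulVec_add_smul_of_eq_zero hA (by rw [hz, dotProduct_zero]), hz,
    dotProduct_zero, mul_zero, add_zero]
  exact hk _ (by simp [hzk])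

theorem entry_eq_zero_of_dotProduct_mulVec_eq_zero [Ring R] [LinearOrder R]
    [IsStrictOrderedRing R] {N : Matrix ι ι R} (hN : ∀ i j, 0 ≤ N i j) {z : ι → R}
    (hz : ∀ i, 0 ≤ z i) (hzN : z ⬝ᵥ N *ᵥ z = 0) {i j : ι} (hi : 0 < z i) (hj : 0 < z j) :
    N i j = 0 := by
  have hterm : ∀ i j, 0 ≤ N i j * z j := fun i j => mul_nonneg (hN i j) (hz j)
  have hrow : (N *ᵥ z) i = 0 := by
    have h := (Finset.sum_eq_zero_iff_of_nonneg fun i _ =>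
      mul_nonneg (hz i) (Finset.sum_nonneg fun j _ => hterm i j)).1 hzN i (Finset.mem_univ i)
    exact (mul_eq_zero.1 h).resolve_left hi.ne'
  have h := (Finset.sum_eq_zero_iff_of_nonneg fun j _ => hterm i j).1 hrow j (Finset.mem_univ j)
  exact (mul_eq_zero.1 h).resolve_right hj.ne'

end QuadraticForm

section Zeros

variable {n : ℕ} {A : Matrix (Fin n) (Fin n) ℝ}

/-- A zero of the quadratic form of `A` in the nonnegative orthant. In contrast to the usual notion
of a zero of a copositive matrix, `z = 0` is allowed. -/
structure IsNonnegZero (A : Matrix (Fin n) (Fin n) ℝ) (z : Fin n → ℝ) : Prop where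
  nonneg : ∀ i, 0 ≤ z i
  dotProduct_mulVec : z ⬝ᵥ A *ᵥ z = 0

variable {y z : Fin n → ℝ}

theorem IsCopositive.mulVec_nonneg (hA : IsCopositive A) (hz : IsNonnegZero A z) (i : Fin n) :
    0 ≤ (A *ᵥ z) i := by
  have hline : ∀ s : ℝ, 0 ≤ s → 0 ≤ A i i + 2 * s * (A *ᵥ z) i := fun s hs => by
    have hsingle : (0 : Fin n → ℝ) ≤ Pi.single i 1 := Pi.single_nonneg.2 zero_le_one
    have h := hA.2 (Pi.single i 1 + s • z) fun j =>
      add_nonneg (hsingle j) (mul_nonneg hs (hz.nonneg j))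
    rw [dotProduct_mulVec_add_smul_of_eq_zero hA.1 hz.dotProduct_mulVec] at h
    simpa using h
  have hdiag : 0 ≤ A i i := by simpa using hline 0 le_rfl
  by_contra! hneg
  have h := hline ((A i i + 1) / -(A *ᵥ z) i) (div_nonneg (by linarith) (by linarith))
  rw [mul_assoc, div_neg, neg_mul, div_mul_cancel₀ _ hneg.ne] at h
  linarith

theorem IsCopositive.mulVec_eq_zero_of_pos (hA : IsCopositive A) (hz : IsNonnegZero A z)
    {i : Fin n} (hi : 0 < z i) : (A *ᵥ z) i = 0 := by
  have h := (Finset.sum_eq_zero_iff_of_nonneg fun j _ =>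
    mul_nonneg (hz.nonneg j) (hA.mulVec_nonneg hz j)).1 hz.dotProduct_mulVec i (Finset.mem_univ i)
  exact (mul_eq_zero.1 h).resolve_left hi.ne'

theorem IsCopositive.dotProduct_mulVec_nonneg_of_support (hA : IsCopositive A)
    (hz : IsNonnegZero A z) {v : Fin n → ℝ} (hv : ∀ i, z i = 0 → v i = 0) :
    0 ≤ v ⬝ᵥ A *ᵥ v := by
  obtain ⟨s, hs⟩ := (Set.finite_range fun i => -v i / z i).bddAbove
  have hnonneg : ∀ i, 0 ≤ (v + s • z) i := fun i => by
    rcases (hz.nonneg i).eq_or_lt with h | h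
    · simp [← h, hv i h.symm]
    · have := (div_le_iff₀ h).1 (hs ⟨i, rfl⟩)
      simp only [Pi.add_apply, Pi.smul_apply, smul_eq_mul]
      linarith
  have horth : v ⬝ᵥ A *ᵥ z = 0 := Finset.sum_eq_zero fun i _ => by
    rcases (hz.nonneg i).eq_or_lt with h | h
    · rw [hv i h.symm, zero_mul]
    · rw [hA.mulVec_eq_zero_of_pos hz h, mul_zero]
  simpa [dotProduct_mulVec_add_smul_of_eq_zero hA.1 hz.dotProduct_mulVec, horth]
    using hA.2 _ hnonneg

theorem IsCopositive.dotProduct_mulVec_eq_zero_of_zeros (hA : IsCopositive A) {k : Fin n}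
    (hk : ∀ v : Fin n → ℝ, v k = 0 → 0 ≤ v ⬝ᵥ A *ᵥ v) (hy : IsNonnegZero A y)
    (hz : IsNonnegZero A z) (hyk : 0 < y k) (hzk : 0 < z k) : y ⬝ᵥ A *ᵥ z = 0 := by
  have hnonneg : 0 ≤ y ⬝ᵥ A *ᵥ z :=
    Finset.sum_nonneg fun i _ => mul_nonneg (hy.nonneg i) (hA.mulVec_nonneg hz i)
  have hdiff : 0 ≤ -(2 * (y k * z k)) * (y ⬝ᵥ A *ᵥ z) := by
    have h := hk (z k • y + (-y k) • z) (by simp [mul_comm])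
    rw [dotProduct_mulVec_add_smul_of_eq_zero hA.1 hz.dotProduct_mulVec] at h
    simp only [mulVec_smul, smul_dotProduct, dotProduct_smul, smul_eq_mul,
      hy.dotProduct_mulVec] at h
    linarith
  have hpos : 0 < 2 * (y k * z k) := by positivity
  nlinarith

theorem IsCopositive.mulVec_eq_zero_of_cover (hA : IsCopositive A) {k : Fin n}
    (hk : ∀ v : Fin n → ℝ, v k = 0 → 0 ≤ v ⬝ᵥ A *ᵥ v)
    (hcover : ∀ i, ∃ y, IsNonnegZero A y ∧ 0 < y k ∧ 0 < y i)
    (hz : IsNonnegZero A z) (hzk : 0 < z k) : A *ᵥ z = 0 := by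
  funext i
  obtain ⟨y, hy, hyk, hyi⟩ := hcover i
  have h := (Finset.sum_eq_zero_iff_of_nonneg fun j _ =>
    mul_nonneg (hy.nonneg j) (hA.mulVec_nonneg hz j)).1
      (hA.dotProduct_mulVec_eq_zero_of_zeros hk hy hz hyk hzk) i (Finset.mem_univ i)
  exact (mul_eq_zero.1 h).resolve_left hyi.ne'

theorem IsCopositive.posSemidef_of_cover (hA : IsCopositive A) {k : Fin n}
    (hk : ∀ v : Fin n → ℝ, v k = 0 → 0 ≤ v ⬝ᵥ A *ᵥ v)
    (hcover : ∀ i, ∃ z, IsNonnegZero A z ∧ 0 < z k ∧ 0 < z i) : A.PosSemidef := by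
  obtain ⟨z, hz, hzk, -⟩ := hcover k
  exact posSemidef_of_mulVec_eq_zero hA.1 hk hzk.ne' (hA.mulVec_eq_zero_of_cover hk hcover hz hzk)

theorem IsCopositive.isExceptional_of_cover (hA : IsCopositive A) (hpsd : ¬ A.PosSemidef)
    (hcover : ∀ i j, ∃ z, IsNonnegZero A z ∧ 0 < z i ∧ 0 < z j) : IsExceptional A := by
  refine ⟨hA, ?_⟩
  rintro ⟨P, N, hP, ⟨-, hN⟩, rfl⟩
  have hN0 : N = 0 := by
    ext i j
    obtain ⟨z, hz, hi, hj⟩ := hcover i j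
    have hsum := hz.dotProduct_mulVec
    rw [add_mulVec, dotProduct_add] at hsum
    have hPz := (posSemidef_iff_isSymm_and_dotProduct_mulVec_nonneg.1 hP).2 z
    have hNz : 0 ≤ z ⬝ᵥ N *ᵥ z := dotProduct_nonneg_of_nonneg hz.nonneg fun i =>
      dotProduct_nonneg_of_nonneg (hN i) hz.nonneg
    exact entry_eq_zero_of_dotProduct_mulVec_eq_zero hN hz.nonneg (by linarith) hi hj
  exact hpsd (by rwa [hN0, add_zero])

end Zeros

section Cyclic

variable {n : ℕ} [NeZero n]

theorem cyc_val (i : Fin n) : cyc n (i : ℕ) = i :=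
  Fin.ofNat_val_eq_self i

theorem cyc_add (a b : ℕ) : cyc n (a + b) = cyc n a + cyc n b :=
  Fin.ext (by simp [cyc, Fin.val_add])

theorem idx_cyc (t : ℕ) (i : Fin (n - 2)) : idx n (cyc n t) i = cyc n (t + i) := by
  rw [idx, cyc_add, cyc_val, ← cyc_add]

theorem exists_cyc_add_eq (k : ℕ) (r : Fin n) : ∃ i < n, cyc n (k + i) = r :=
  ⟨(r - cyc n k : Fin n), Fin.is_lt _, by rw [cyc_add, cyc_val, add_sub_cancel]⟩

theorem cyc_add_inj (k : ℕ) {i j : ℕ} (hi : i < n) (hj : j < n) :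
    cyc n (k + i) = cyc n (k + j) ↔ i = j := by
  rw [cyc_add, cyc_add, add_right_inj, Fin.ext_iff]
  simp [cyc, Nat.mod_eq_of_lt, hi, hj]

theorem sum_cyc_add {M : Type*} [AddCommMonoid M] (k : ℕ) (f : Fin n → M) :
    ∑ i ∈ Finset.range n, f (cyc n (k + i)) = ∑ i, f i := by
  rw [Finset.sum_range, ← Equiv.sum_comp (Equiv.addLeft (cyc n k)) f]
  simp only [cyc_add, cyc_val, Equiv.coe_addLeft]

variable {u : Fin n → Fin n → ℝ}

theorem HasCirculantSupports.coeff_pos_iff (hu : HasCirculantSupports u) (t : ℕ) {i : ℕ}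
    (hi : i < n) : 0 < coeff u t i ↔ i < n - 2 := by
  have hmem : 0 < coeff u t i ↔ cyc n (t + i) ∈ Set.range (idx n (cyc n t)) := by
    rw [← (hu (cyc n t)).2]
    rfl
  rw [hmem]
  constructor
  · rintro ⟨m, hm⟩
    rw [idx_cyc, cyc_add_inj t (by omega) hi] at hm
    omega
  · exact fun h => ⟨⟨i, h⟩, idx_cyc t _⟩

theorem HasCirculantSupports.coeff_zero_pos (hn : 3 ≤ n) (hu : HasCirculantSupports u) (t : ℕ) :
    0 < coeff u t 0 :=
  (hu.coeff_pos_iff t (by omega)).2 (by omega)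

theorem HasCirculantSupports.apply_eq_zero_iff (hn : 2 ≤ n) (hu : HasCirculantSupports u) (t : ℕ)
    (r : Fin n) : u (cyc n (t + 2)) r = 0 ↔ r = cyc n t ∨ r = cyc n (t + 1) := by
  obtain ⟨i, hi, rfl⟩ := exists_cyc_add_eq (t + 2) r
  have hfirst : cyc n (t + 2 + (n - 2)) = cyc n t := by
    rw [show t + 2 + (n - 2) = t + n by omega, cyc_add_period]
  have hsecond : cyc n (t + 2 + (n - 1)) = cyc n (t + 1) := by
    rw [show t + 2 + (n - 1) = t + 1 + n by omega, cyc_add_period]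
  have hpos := hu.coeff_pos_iff (t + 2) hi
  rw [coeff, ((hu _).1 _).lt_iff_ne'] at hpos
  rw [← not_iff_not, ← Ne, hpos, ← hfirst, ← hsecond, cyc_add_inj _ hi (by omega),
    cyc_add_inj _ hi (by omega)]
  omega

theorem HasCirculantSupports.exists_pos_pos (hn : 5 ≤ n) (hu : HasCirculantSupports u)
    (k i : Fin n) : ∃ j, 0 < u j k ∧ 0 < u j i := by
  obtain ⟨m, hm, rfl⟩ := exists_cyc_add_eq (k : ℕ) i
  have hk : 0 < u k k := by simpa [coeff, cyc_val] using hu.coeff_zero_pos (by omega) (k : ℕ)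
  by_cases h : m < n - 2
  · refine ⟨k, hk, ?_⟩
    simpa [coeff, cyc_val] using (hu.coeff_pos_iff (k : ℕ) hm).2 h
  · refine ⟨cyc n (k + m), ?_, hu.coeff_zero_pos (by omega) (k + m)⟩
    have hlast := (hu.coeff_pos_iff (k + m) (i := n - m) (by omega)).2 (by omega)
    rwa [coeff, show (k : ℕ) + m + (n - m) = k + n by omega, cyc_add_period, cyc_val] at hlast

theorem HasCirculantSupports.sum_window {M : Type*} [AddCommMonoid M] (hn : 3 ≤ n)
    (hu : HasCirculantSupports u) (t : ℕ) {f : Fin n → M}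
    (hf : ∀ i, u (cyc n t) i = 0 → f i = 0) :
    ∑ i ∈ Finset.range (n - 3 + 1), f (cyc n (t + i)) = ∑ i, f i := by
  rw [← sum_cyc_add t]
  refine Finset.sum_subset (Finset.range_mono (by omega)) fun i hi hi' => hf _ ?_
  rw [Finset.mem_range] at hi hi'
  exact le_antisymm (not_lt.1 ((hu.coeff_pos_iff t hi).not.2 (by omega))) ((hu _).1 _)

theorem HasCirculantSupports.mulVec_apply_eq_sum_window (hn : 3 ≤ n) (hu : HasCirculantSupports u)
    (A : Matrix (Fin n) (Fin n) ℝ) (t : ℕ) (r : Fin n) : (A *ᵥ u (cyc n t)) r =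
      ∑ i ∈ Finset.range (n - 3 + 1), coeff u t i * A r (cyc n (t + i)) := by
  rw [mulVec, dotProduct, ← hu.sum_window hn t fun i hi => by rw [hi, mul_zero]]
  simp only [coeff, mul_comm]

theorem HasCirculantSupports.mem_spaceA_iff (hu : HasCirculantSupports u)
    {A : Matrix (Fin n) (Fin n) ℝ} :
    A ∈ spaceA u ↔ A.IsSymm ∧ ∀ j i, 0 < u j i → (A *ᵥ u j) i = 0 := by
  have hsub : ∀ j i, (A.submatrix (idx n j) (idx n j) *ᵥ (u j ∘ idx n j)) i =
      (A *ᵥ u j) (idx n j i) := fun j i => by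
    refine Fintype.sum_of_injective (idx n j) (fun a b hab => ?_) _ _ (fun k hk => ?_) fun _ => rfl
    · exact Fin.ext ((cyc_add_inj (j : ℕ) (by omega) (by omega)).1 hab)
    · rw [← (hu j).2] at hk
      rw [le_antisymm (not_lt.1 hk) ((hu j).1 k), mul_zero]
  refine and_congr_right fun _ => forall_congr' fun j => ?_
  rw [funext_iff]
  simp only [hsub, Pi.zero_apply]
  rw [← Set.forall_mem_range (p := fun i => (A *ᵥ u j) i = 0), ← (hu j).2]
  rfl

theorem HasCirculantSupports.mem_spaceA_iff_sum_window (hn : 3 ≤ n) (hu : HasCirculantSupports u)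
    {A : Matrix (Fin n) (Fin n) ℝ} : A ∈ spaceA u ↔ A.IsSymm ∧ ∀ t, ∀ a ≤ n - 3,
      ∑ i ∈ Finset.range (n - 3 + 1), coeff u t i * A (cyc n (t + a)) (cyc n (t + i)) = 0 := by
  simp only [hu.mem_spaceA_iff, ← hu.mulVec_apply_eq_sum_window hn]
  refine and_congr_right fun _ => ⟨fun h t a ha => ?_, fun h j r hr => ?_⟩
  · exact h _ _ ((hu.coeff_pos_iff t (by omega)).2 (by omega))
  · obtain ⟨t, -, rfl⟩ := exists_cyc_add_eq 0 j
    obtain ⟨a, ha, rfl⟩ := exists_cyc_add_eq (0 + t) r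
    have := (hu.coeff_pos_iff (0 + t) ha).1 hr
    exact h _ a (by omega)

end Cyclic

section Faces

variable {n : ℕ} [NeZero n] {u : Fin n → Fin n → ℝ} {A : Matrix (Fin n) (Fin n) ℝ}

/-- The principal submatrices `A_{I_j}` are positive semi-definite, stated as nonnegativity of the
quadratic form of `A` on the vectors supported in `I_j`. Symmetry of `A` is not part of it. -/
def PosSemidefOnSupports (u : Fin n → Fin n → ℝ) (A : Matrix (Fin n) (Fin n) ℝ) : Prop :=
  ∀ j (v : Fin n → ℝ), (∀ i, u j i = 0 → v i = 0) → 0 ≤ v ⬝ᵥ A *ᵥ v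

/-- The entry of `A u^{t+2}` at the index `t ∉ I_{t+2}`. Up to a positive factor it is the
difference of the two sides of the inequality with index `t` for the form `Λ(A)`. -/
def slack (u : Fin n → Fin n → ℝ) (A : Matrix (Fin n) (Fin n) ℝ) (t : ℕ) : ℝ :=
  (A *ᵥ u (cyc n (t + 2))) (cyc n t)

theorem dotProduct_mulVec_eq_mul_of_mem_spaceA (hu : HasCirculantSupports u) (hA : A ∈ spaceA u)
    {j i : Fin n} {x : Fin n → ℝ} (hx : ∀ k, k ≠ i → u j k = 0 → x k = 0) :
    x ⬝ᵥ A *ᵥ u j = x i * (A *ᵥ u j) i := by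
  refine Finset.sum_eq_single i (fun k _ hk => ?_) fun h => absurd (Finset.mem_univ i) h
  rcases ((hu j).1 k).eq_or_lt with h | h
  · rw [hx k hk h.symm, zero_mul]
  · rw [(hu.mem_spaceA_iff.1 hA).2 j k h, mul_zero]

theorem isNonnegZero_of_mem_spaceA (hu : HasCirculantSupports u) (hA : A ∈ spaceA u) (j : Fin n) :
    IsNonnegZero A (u j) := by
  refine ⟨(hu j).1, Finset.sum_eq_zero fun k _ => ?_⟩
  rcases ((hu j).1 k).eq_or_lt with h | h
  · rw [← h, zero_mul]
  · rw [(hu.mem_spaceA_iff.1 hA).2 j k h, mul_zero]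

theorem isNonnegZero_of_mem_faceF (hu : HasCirculantSupports u) (hA : A ∈ faceF u) (j : Fin n) :
    IsNonnegZero A (u j) :=
  ⟨(hu j).1, hA.2 j⟩

theorem mulVec_apply_eq_mul_slack (hn : 3 ≤ n) (hu : HasCirculantSupports u) (hA : A ∈ spaceA u)
    (t : ℕ) : (A *ᵥ u (cyc n (t + 3))) (cyc n (t + 2)) =
      u (cyc n (t + 3)) (cyc n t) / u (cyc n (t + 2)) (cyc n (t + 2)) * slack u A t := by
  have hfirst := hu.apply_eq_zero_iff (by omega) t
  have hsecond := hu.apply_eq_zero_iff (by omega) (t + 1)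
  have hpos : 0 < u (cyc n (t + 2)) (cyc n (t + 2)) := hu.coeff_zero_pos hn (t + 2)
  have hsymm : u (cyc n (t + 2)) (cyc n (t + 2)) * (A *ᵥ u (cyc n (t + 3))) (cyc n (t + 2)) =
      u (cyc n (t + 3)) (cyc n t) * slack u A t := by
    rw [slack, ← dotProduct_mulVec_eq_mul_of_mem_spaceA hu hA,
      ← dotProduct_mulVec_eq_mul_of_mem_spaceA hu hA,
      dotProduct_mulVec_comm_of_isSymm (hu.mem_spaceA_iff.1 hA).1]
    · exact fun k hk h => (hsecond k).2 (.inl (((hfirst k).1 h).resolve_left hk))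
    · exact fun k hk h => (hfirst k).2 (.inr (((hsecond k).1 h).resolve_right hk))
  rw [div_mul_eq_mul_div, eq_div_iff hpos.ne', ← hsymm, mul_comm]

theorem exists_mulVec_eq_mul_slack (hn : 3 ≤ n) (hu : HasCirculantSupports u) (hA : A ∈ spaceA u)
    (j r : Fin n) : ∃ a t, 0 ≤ a ∧ (A *ᵥ u j) r = a * slack u A t := by
  obtain ⟨m, -, rfl⟩ := exists_cyc_add_eq 2 j
  rw [add_comm]
  by_cases hr : u (cyc n (m + 2)) r = 0
  · rcases (hu.apply_eq_zero_iff (by omega) m r).1 hr with rfl | rfl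
    · exact ⟨1, m, zero_le_one, (one_mul _).symm⟩
    · have h := mulVec_apply_eq_mul_slack hn hu hA (m + (n - 1))
      rw [show m + (n - 1) + 3 = m + 2 + n by omega, show m + (n - 1) + 2 = m + 1 + n by omega,
        cyc_add_period, cyc_add_period] at h
      exact ⟨_, _, div_nonneg ((hu _).1 _) ((hu _).1 _), h⟩
  · refine ⟨0, 0, le_rfl, ?_⟩
    rw [zero_mul, (hu.mem_spaceA_iff.1 hA).2 _ _ (((hu _).1 _).lt_of_ne' hr)]

theorem dotProduct_mulVec_nonneg_of_apply_eq_zero (hn : 3 ≤ n) (hu : HasCirculantSupports u)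
    (hA : A ∈ spaceA u) (hpsd : PosSemidefOnSupports u A) (t : ℕ) {x : Fin n → ℝ}
    (hx : x (cyc n (t + 1)) = 0) (hslack : 0 ≤ x (cyc n (t + 2)) * x (cyc n t) * slack u A t) :
    0 ≤ x ⬝ᵥ A *ᵥ x := by
  have hzero := hu.apply_eq_zero_iff (by omega) t
  have hpos : 0 < u (cyc n (t + 2)) (cyc n (t + 2)) := hu.coeff_zero_pos hn (t + 2)
  set z := u (cyc n (t + 2))
  set r := x (cyc n (t + 2)) / z (cyc n (t + 2)) with hr
  set v := x - r • z with hv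
  have hv_apply : ∀ {k}, z k = 0 → v k = x k := fun {k} hk => by simp [hv, hk]
  have hv_first : v (cyc n (t + 1)) = 0 := by rw [hv_apply ((hzero _).2 (.inr rfl)), hx]
  have hv_second : v (cyc n (t + 2)) = 0 := by simp [hv, hr, hpos.ne']
  have hvAv : 0 ≤ v ⬝ᵥ A *ᵥ v := hpsd (cyc n (t + 3)) v fun k hk => by
    rcases (hu.apply_eq_zero_iff (by omega) (t + 1) k).1 hk with rfl | rfl
    exacts [hv_first, hv_second]
  have hvAz : v ⬝ᵥ A *ᵥ z = x (cyc n t) * slack u A t := by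
    rw [dotProduct_mulVec_eq_mul_of_mem_spaceA hu hA (i := cyc n t),
      hv_apply ((hzero _).2 (.inl rfl)), slack]
    rintro k hk h
    rwa [((hzero k).1 h).resolve_left hk]
  rw [show x = v + r • z by simp [hv], dotProduct_mulVec_add_smul_of_eq_zero
    (hu.mem_spaceA_iff.1 hA).1 (isNonnegZero_of_mem_spaceA hu hA _).dotProduct_mulVec, hvAz]
  have hcross : 2 * r * (x (cyc n t) * slack u A t) =
      2 * (x (cyc n (t + 2)) * x (cyc n t) * slack u A t) / z (cyc n (t + 2)) := by
    rw [hr]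
    ring
  rw [hcross]
  positivity

theorem isCopositive_of_slack_nonneg (hn : 3 ≤ n) (hu : HasCirculantSupports u)
    (hA : A ∈ spaceA u) (hpsd : PosSemidefOnSupports u A) (hslack : ∀ t, 0 ≤ slack u A t) :
    IsCopositive A := by
  refine ⟨(hu.mem_spaceA_iff.1 hA).1, fun x hx => ?_⟩
  set j := cyc n 0
  obtain ⟨r, hr, hy, k, hk⟩ :=
    exists_sub_smul_nonneg_and_apply_eq_zero hx (hu j).1 (hu.coeff_zero_pos hn 0)
  obtain ⟨t, -, rfl⟩ := exists_cyc_add_eq 1 k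
  rw [add_comm 1 t] at hk
  have hyAy : 0 ≤ (x - r • u j) ⬝ᵥ A *ᵥ (x - r • u j) :=
    dotProduct_mulVec_nonneg_of_apply_eq_zero hn hu hA hpsd t hk
      (mul_nonneg (mul_nonneg (hy _) (hy _)) (hslack t))
  have hyAu : 0 ≤ (x - r • u j) ⬝ᵥ A *ᵥ u j := dotProduct_nonneg_of_nonneg hy fun i => by
    obtain ⟨a, s, ha, h⟩ := exists_mulVec_eq_mul_slack hn hu hA j i
    rw [Pi.zero_apply, h]
    exact mul_nonneg ha (hslack s)
  rw [← sub_add_cancel x (r • u j), dotProduct_mulVec_add_smul_of_eq_zero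
    (hu.mem_spaceA_iff.1 hA).1 (isNonnegZero_of_mem_spaceA hu hA j).dotProduct_mulVec]
  positivity

theorem mem_faceF_iff (hn : 3 ≤ n) (hu : HasCirculantSupports u) :
    A ∈ faceF u ↔ A ∈ spaceA u ∧ PosSemidefOnSupports u A ∧ ∀ t, 0 ≤ slack u A t := by
  constructor
  · intro hA
    have hzero := isNonnegZero_of_mem_faceF hu hA
    exact ⟨hu.mem_spaceA_iff.2 ⟨hA.1.1, fun j _ => hA.1.mulVec_eq_zero_of_pos (hzero j)⟩,
      fun j _ => hA.1.dotProduct_mulVec_nonneg_of_support (hzero j),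
      fun t => hA.1.mulVec_nonneg (hzero _) _⟩
  · rintro ⟨hA, hpsd, hslack⟩
    exact ⟨isCopositive_of_slack_nonneg hn hu hA hpsd hslack,
      fun j => (isNonnegZero_of_mem_spaceA hu hA j).dotProduct_mulVec⟩

theorem mem_faceP_of_slack_eq_zero (hn : 5 ≤ n) (hu : HasCirculantSupports u) (hA : A ∈ faceF u)
    {t : ℕ} (ht : slack u A t = 0) : A ∈ faceP u := by
  obtain ⟨hAspace, hpsd, -⟩ := (mem_faceF_iff (by omega) hu).1 hA
  refine ⟨hA.1.posSemidef_of_cover (k := cyc n (t + 1)) (fun v hv => ?_) fun i => ?_, hA.2⟩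
  · exact dotProduct_mulVec_nonneg_of_apply_eq_zero (by omega) hu hAspace hpsd t hv
      (by rw [ht, mul_zero])
  · obtain ⟨j, hk, hi⟩ := hu.exists_pos_pos hn (cyc n (t + 1)) i
    exact ⟨u j, isNonnegZero_of_mem_faceF hu hA j, hk, hi⟩

theorem mem_faceP_iff (hn : 5 ≤ n) (hu : HasCirculantSupports u) :
    A ∈ faceP u ↔ A ∈ faceF u ∧ ∀ t, slack u A t = 0 := by
  refine ⟨fun hA => ?_, fun hA => mem_faceP_of_slack_eq_zero hn hu hA.1 (hA.2 0)⟩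
  obtain ⟨hsymm, hnonneg⟩ := posSemidef_iff_isSymm_and_dotProduct_mulVec_nonneg.1 hA.1
  refine ⟨⟨⟨hsymm, fun x _ => hnonneg x⟩, hA.2⟩, fun t => ?_⟩
  have hzero := (hA.1.dotProduct_mulVec_zero_iff (u (cyc n (t + 2)))).1 (by simpa using hA.2 _)
  rw [slack, hzero, Pi.zero_apply]

theorem isExceptional_of_mem_faceF_diff_faceP (hn : 5 ≤ n) (hu : HasCirculantSupports u)
    (hA : A ∈ faceF u \ faceP u) : IsExceptional A := by
  refine hA.1.1.isExceptional_of_cover (fun hpsd => hA.2 ⟨hpsd, hA.1.2⟩) fun i k => ?_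
  obtain ⟨j, hi, hk⟩ := hu.exists_pos_pos hn i k
  exact ⟨u j, isNonnegZero_of_mem_faceF hu hA.1 j, hi, hk⟩

end Faces

section Recursion

theorem eq_zero_of_sum_mul_eq_zero {R : Type*} [Semiring R] [NoZeroDivisors R] {d : ℕ}
    {c h : ℕ → R} (hc : c d ≠ 0) (hsum : ∑ i ∈ Finset.range (d + 1), c i * h i = 0)
    (hh : ∀ i < d, h i = 0) : h d = 0 := by
  rw [Finset.sum_range_succ, Finset.sum_eq_zero, zero_add] at hsum
  · exact (mul_eq_zero.1 hsum).resolve_left hc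
  · intro i hi
    rw [hh i (Finset.mem_range.1 hi), mul_zero]

theorem eq_zero_on_windows {R : Type*} [Semiring R] [NoZeroDivisors R] {d : ℕ}
    {c H : ℕ → ℕ → R} (hc : ∀ t, c t d ≠ 0) (hsymm : ∀ t s, H t s = H s t)
    (hrec : ∀ t, ∀ a ≤ d, ∑ i ∈ Finset.range (d + 1), c t i * H (t + a) (t + i) = 0)
    (hinit : ∀ a < d, ∀ b < d, H a b = 0) (t : ℕ) :
    ∀ a ≤ d, ∀ b ≤ d, H (t + a) (t + b) = 0 := by
  have hrow : ∀ t, ∀ a ≤ d, (∀ b < d, H (t + a) (t + b) = 0) → ∀ b ≤ d, H (t + a) (t + b) = 0 :=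
    fun t a ha h b hb => by
      rcases hb.lt_or_eq with hbd | rfl
      · exact h b hbd
      · exact eq_zero_of_sum_mul_eq_zero (h := fun b => H (t + a) (t + b)) (hc t) (hrec t a ha) h
  have hwindow : ∀ t, (∀ a < d, ∀ b < d, H (t + a) (t + b) = 0) →
      ∀ a ≤ d, ∀ b ≤ d, H (t + a) (t + b) = 0 := fun t h a ha =>
    hrow t a ha fun b hb => hsymm (t + a) (t + b) ▸ hrow t b hb.le (h b hb) a ha
  refine hwindow t ?_
  induction t with
  | zero => simpa only [zero_add] using hinit
  | succ t ih =>
    intro a ha b hb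
    rw [add_assoc, add_assoc]
    exact hwindow t ih _ (by omega) _ (by omega)

end Recursion

section Forms

variable {d : ℕ} {c : ℕ → ℕ → ℝ}

theorem sum_smul_ev_eq_zero (t : ℕ) :
    ∑ i ∈ Finset.range (d + 1), c t i • (ev (t + i) : Module.Dual ℝ (solutions d c)) = 0 := by
  ext x
  simpa using x.2 t

theorem sum_mul_bilinForm_ev_eq_zero (B : LinearMap.BilinForm ℝ (Module.Dual ℝ (solutions d c)))
    (f : Module.Dual ℝ (solutions d c)) (t : ℕ) :
    ∑ i ∈ Finset.range (d + 1), c t i * B f (ev (t + i)) = 0 := by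
  simpa using congrArg (B f) (sum_smul_ev_eq_zero t)

theorem bilinForm_ext_ev (hc : ∀ t, c t d ≠ 0)
    {B C : LinearMap.BilinForm ℝ (Module.Dual ℝ (solutions d c))}
    (h : ∀ t < d, ∀ s < d, B (ev t) (ev s) = C (ev t) (ev s)) : B = C :=
  LinearMap.BilinForm.ext_basis (evBasis hc) fun i j => by
    simpa only [evBasis_apply] using h i i.2 j j.2

end Forms

section Windows

variable {n : ℕ} [NeZero n] {u : Fin n → Fin n → ℝ} {A : Matrix (Fin n) (Fin n) ℝ}
  {B : LinearMap.BilinForm ℝ (Module.Dual ℝ (solSpace u))}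

/-- `B(e_t, e_s) = A_{ts}` whenever `t` and `s` lie in a common window of length `n - 2`. The
bound is written without subtracting `t` and `s`, which would truncate. -/
def AgreesOnWindows (A : Matrix (Fin n) (Fin n) ℝ)
    (B : LinearMap.BilinForm ℝ (Module.Dual ℝ (solSpace u))) : Prop :=
  ∀ t s : ℕ, s ≤ t + (n - 3) → t ≤ s + (n - 3) → B (ev t) (ev s) = A (cyc n t) (cyc n s)

theorem AgreesOnWindows.mem_spaceA (hn : 3 ≤ n) (hu : HasCirculantSupports u) (hA : A.IsSymm)
    (hAB : AgreesOnWindows A B) : A ∈ spaceA u := by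
  refine (hu.mem_spaceA_iff_sum_window hn).2 ⟨hA, fun t a ha => ?_⟩
  rw [← sum_mul_bilinForm_ev_eq_zero B (ev (t + a)) t]
  refine Finset.sum_congr rfl fun i hi => ?_
  rw [Finset.mem_range] at hi
  rw [hAB _ _ (by omega) (by omega)]

theorem AgreesOnWindows.slack_eq (hn : 5 ≤ n) (hu : HasCirculantSupports u)
    (hAB : AgreesOnWindows A B) (t : ℕ) : slack u A t =
      coeff u (t + 2) 0 * (B (ev t) (ev (t + 2)) - B (ev (t + n)) (ev (t + 2))) := by
  have hwrap : ∀ i ∈ Finset.range (n - 3), A (cyc n t) (cyc n (t + 2 + (i + 1))) =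
      B (ev (t + n)) (ev (t + 2 + (i + 1))) := fun i hi => by
    rw [Finset.mem_range] at hi
    rw [hAB _ _ (by omega) (by omega), cyc_add_period]
  have hrec := sum_mul_bilinForm_ev_eq_zero B (ev (t + n)) (t + 2)
  rw [Finset.sum_range_succ', add_zero] at hrec
  rw [slack, hu.mulVec_apply_eq_sum_window (by omega), Finset.sum_range_succ', add_zero,
    Finset.sum_congr rfl fun i hi => by rw [hwrap i hi], ← hAB t (t + 2) (by omega) (by omega)]
  linarith

theorem AgreesOnWindows.dotProduct_mulVec_eq (hn : 3 ≤ n) (hu : HasCirculantSupports u)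
    (hAB : AgreesOnWindows A B) (t : ℕ) {v : Fin n → ℝ} (hv : ∀ i, u (cyc n t) i = 0 → v i = 0) :
    v ⬝ᵥ A *ᵥ v = B (∑ i ∈ Finset.range (n - 3 + 1), v (cyc n (t + i)) • ev (t + i))
      (∑ i ∈ Finset.range (n - 3 + 1), v (cyc n (t + i)) • ev (t + i)) := by
  have hrow : ∀ r, (A *ᵥ v) r =
      ∑ j ∈ Finset.range (n - 3 + 1), A r (cyc n (t + j)) * v (cyc n (t + j)) := fun r =>
    (hu.sum_window hn t fun i hi => by rw [hv i hi, mul_zero]).symm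
  rw [dotProduct, ← hu.sum_window hn t fun i hi => by rw [hv i hi, zero_mul], LinearMap.map_sum₂]
  refine Finset.sum_congr rfl fun i hi => ?_
  rw [LinearMap.map_smul₂, map_sum, hrow, smul_eq_mul]
  refine congrArg _ (Finset.sum_congr rfl fun j hj => ?_)
  rw [Finset.mem_range] at hi hj
  rw [map_smul, hAB _ _ (by omega) (by omega), smul_eq_mul, mul_comm]

theorem exists_eq_sum_window (hn : 5 ≤ n) (hu : HasCirculantSupports u)
    (f : Module.Dual ℝ (solSpace u)) : ∃ v : Fin n → ℝ, (∀ i, u (cyc n 0) i = 0 → v i = 0) ∧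
      f = ∑ i ∈ Finset.range (n - 3 + 1), v (cyc n (0 + i)) • ev (0 + i) := by
  set y := (evBasis (coeff_ne_zero hn hu)).repr f
  refine ⟨fun k => if h : (k : ℕ) < n - 3 then y ⟨k, h⟩ else 0, fun k hk => dif_neg fun h => ?_, ?_⟩
  · have hpos := (hu.coeff_pos_iff 0 k.2).2 (by omega)
    rw [coeff, zero_add, cyc_val, hk] at hpos
    exact hpos.false
  · have hval : ∀ {i}, i < n → (cyc n i : ℕ) = i := Nat.mod_eq_of_lt
    rw [Finset.sum_range_succ, Finset.sum_range]
    simp only [zero_add, hval (show n - 3 < n by omega), lt_irrefl, dite_false, zero_smul, add_zero]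
    refine ((evBasis (coeff_ne_zero hn hu)).sum_repr f).symm.trans
      (Finset.sum_congr rfl fun i _ => ?_)
    simp only [hval (show (i : ℕ) < n by omega), i.2, dite_true, evBasis_apply, y]

theorem AgreesOnWindows.nonneg_iff (hn : 5 ≤ n) (hu : HasCirculantSupports u)
    (hAB : AgreesOnWindows A B) : (∀ f, 0 ≤ B f f) ↔ PosSemidefOnSupports u A := by
  constructor
  · intro hB j v hv
    rw [hAB.dotProduct_mulVec_eq (by omega) hu j (by rwa [cyc_val])]
    exact hB _
  · intro hA f
    obtain ⟨v, hv, rfl⟩ := exists_eq_sum_window hn hu f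
    rw [← hAB.dotProduct_mulVec_eq (by omega) hu 0 hv]
    exact hA _ v hv

end Windows

section Lambda

variable {n : ℕ} [NeZero n] {u : Fin n → Fin n → ℝ}

theorem Lam_isSymm (hn : 5 ≤ n) (hu : HasCirculantSupports u) (A : spaceA u) :
    (Lam hn hu A).IsSymm :=
  (isSymm_toBilin_iff_isSymm _).2 (A.2.1.submatrix _)

theorem agreesOnWindows_Lam (hn : 5 ≤ n) (hu : HasCirculantSupports u) (A : spaceA u) :
    AgreesOnWindows (A : Matrix (Fin n) (Fin n) ℝ) (Lam hn hu A) := by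
  set B := Lam hn hu A
  have hsum := ((hu.mem_spaceA_iff_sum_window (by omega)).1 A.2).2
  have hdiff := eq_zero_on_windows (coeff_ne_zero hn hu)
    (H := fun t s => B (ev t) (ev s) - A.1 (cyc n t) (cyc n s)) (fun t s => ?symm)
    (fun t a ha => ?rec) fun a ha b hb => ?init
  case symm => rw [(Lam_isSymm hn hu A).eq, A.2.1.apply]
  case rec =>
    simp only [mul_sub, Finset.sum_sub_distrib]
    rw [sum_mul_bilinForm_ev_eq_zero, hsum t a ha, sub_zero]
  case init =>
    rw [sub_eq_zero]
    have hcast : ∀ {a} (ha : a < n - 3), cyc n a = Fin.castLE (Nat.sub_le n 3) ⟨a, ha⟩ :=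
      fun {a} ha => cyc_val (Fin.castLE (Nat.sub_le n 3) ⟨a, ha⟩)
    rw [hcast ha, hcast hb]
    exact Lam_ev hn hu A ⟨a, ha⟩ ⟨b, hb⟩
  intro t s hs ht
  rcases le_total t s with h | h
  · simpa [sub_eq_zero, h] using hdiff t 0 (by omega) (s - t) (by omega)
  · simpa [sub_eq_zero, h] using hdiff s (t - s) (by omega) 0 (by omega)

theorem Lam_eq_of_agreesOnWindows (hn : 5 ≤ n) (hu : HasCirculantSupports u) {A : spaceA u}
    {B : LinearMap.BilinForm ℝ (Module.Dual ℝ (solSpace u))}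
    (hAB : AgreesOnWindows (A : Matrix (Fin n) (Fin n) ℝ) B) : Lam hn hu A = B :=
  bilinForm_ext_ev (coeff_ne_zero hn hu) fun t ht s hs => by
    rw [hAB t s (by omega) (by omega), agreesOnWindows_Lam hn hu A t s (by omega) (by omega)]

theorem exists_representatives_mem_window (hn : 5 ≤ n) (i j : Fin n) :
    ∃ t s : ℕ, s ≤ t + (n - 3) ∧ t ≤ s + (n - 3) ∧ cyc n t = i ∧ cyc n s = j := by
  obtain ⟨m, hm, rfl⟩ := exists_cyc_add_eq (i : ℕ) j
  by_cases h : m ≤ n - 3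
  · exact ⟨i, i + m, by omega, by omega, cyc_val i, rfl⟩
  · exact ⟨i + n, i + m, by omega, by omega, by rw [cyc_add_period, cyc_val], rfl⟩

theorem Lam_injective (hn : 5 ≤ n) (hu : HasCirculantSupports u) :
    Function.Injective (Lam hn hu) := by
  intro A A' h
  ext i j
  obtain ⟨t, s, hts, hst, rfl, rfl⟩ := exists_representatives_mem_window hn i j
  rw [← agreesOnWindows_Lam hn hu A t s hts hst, ← agreesOnWindows_Lam hn hu A' t s hts hst, h]

theorem slack_periodic (A : Matrix (Fin n) (Fin n) ℝ) : Function.Periodic (slack u A) n :=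
  fun t => by rw [slack, slack, add_right_comm, cyc_add_period, cyc_add_period]

theorem Lam_mem_formsF_iff (hn : 5 ≤ n) (hu : HasCirculantSupports u) (A : spaceA u) :
    Lam hn hu A ∈ formsF u ↔ (A : Matrix (Fin n) (Fin n) ℝ) ∈ faceF u := by
  have hAB := agreesOnWindows_Lam hn hu A
  rw [mem_faceF_iff (by omega) hu, ← hAB.nonneg_iff hn hu]
  constructor
  · rintro ⟨hB, -, -, hineq⟩
    refine ⟨A.2, hB.isNonneg.nonneg, fun t => ?_⟩
    rw [← (slack_periodic A.1).map_mod_nat, hAB.slack_eq hn hu]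
    exact mul_nonneg (hu.coeff_zero_pos (by omega) _).le
      (sub_nonneg.2 (hineq _ (Nat.mod_lt _ (by omega))))
  · rintro ⟨-, hB, hslack⟩
    refine ⟨⟨Lam_isSymm hn hu A, ⟨hB⟩⟩, fun t ht s hs => ?_, fun t s hts hs h3 hd => ?_,
      fun t _ => ?_⟩
    · simp only [monodromyAdj_ev, hAB t s (by omega) (by omega),
        hAB (t + n) (s + n) (by omega) (by omega), cyc_add_period]
    · simp only [monodromyAdj_ev, hAB t s (by omega) (by omega),
        hAB (t + n) s (by omega) (by omega), cyc_add_period]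
    · have h := hslack t
      rw [hAB.slack_eq hn hu] at h
      exact sub_nonneg.1 (nonneg_of_mul_nonneg_right h (hu.coeff_zero_pos (by omega) _))

theorem slack_eq_zero_iff (hn : 5 ≤ n) (hu : HasCirculantSupports u) (A : spaceA u) (t : ℕ) :
    slack u A t = 0 ↔ Lam hn hu A (ev t) (ev (t + 2)) =
      Lam hn hu A (monodromyAdj u (ev t)) (ev (t + 2)) := by
  rw [(agreesOnWindows_Lam hn hu A).slack_eq hn hu, mul_eq_zero_iff_left
    (hu.coeff_zero_pos (by omega) _).ne', sub_eq_zero, monodromyAdj_ev]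

theorem Lam_mem_formsP_iff (hn : 5 ≤ n) (hu : HasCirculantSupports u) (A : spaceA u) :
    Lam hn hu A ∈ formsP u ↔ (A : Matrix (Fin n) (Fin n) ℝ) ∈ faceP u := by
  rw [mem_faceP_iff hn hu, ← Lam_mem_formsF_iff hn hu A]
  refine and_congr_right fun _ =>
    ⟨fun h t => ?_, fun h t _ => (slack_eq_zero_iff hn hu A t).1 (h t)⟩
  rw [← (slack_periodic A.1).map_mod_nat, slack_eq_zero_iff hn hu]
  exact h _ (Nat.mod_lt _ (by omega))

/-- The matrix with entries `B(e_t, e_s)`, where `t`, `s` are representatives of the row and the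
column index at distance at most `n - 3`: the inverse of `Λ` on the forms in `formsF`. -/
def matrixOfForm (B : LinearMap.BilinForm ℝ (Module.Dual ℝ (solSpace u))) :
    Matrix (Fin n) (Fin n) ℝ :=
  Matrix.of fun i j =>
    if (j : ℕ) ≤ i + (n - 3) then
      if (i : ℕ) ≤ j + (n - 3) then B (ev i) (ev j) else B (ev i) (ev (j + n))
    else B (ev (i + n)) (ev j)

variable {B : LinearMap.BilinForm ℝ (Module.Dual ℝ (solSpace u))}

theorem matrixOfForm_isSymm (hB : B.IsSymm) : (matrixOfForm B).IsSymm := by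
  refine IsSymm.ext fun i j => ?_
  simp only [matrixOfForm, of_apply]
  split_ifs
  any_goals exact hB.eq _ _
  omega

theorem bilinForm_ev_add_period (hn : 5 ≤ n) (hu : HasCirculantSupports u) (hB : B ∈ formsF u)
    (t s : ℕ) : B (ev (t + n)) (ev (s + n)) = B (ev t) (ev s) := by
  have h : B = LinearMap.BilinForm.comp B (monodromyAdj u) (monodromyAdj u) :=
    bilinForm_ext_ev (coeff_ne_zero hn hu) hB.2.1
  exact (LinearMap.congr_fun₂ h (ev t) (ev s)).symm

theorem bilinForm_ev_eq_matrixOfForm_of_lt (hn : 3 ≤ n) (hB : B ∈ formsF u) {t b : ℕ} (ht : t < n)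
    (hb : b ≤ n - 3) : B (ev t) (ev (t + b)) = matrixOfForm B (cyc n t) (cyc n (t + b)) := by
  have hcyc : ∀ {s}, s < n → (cyc n s : ℕ) = s := Nat.mod_eq_of_lt
  by_cases hlt : t + b < n
  · rw [matrixOfForm, of_apply, hcyc ht, hcyc hlt, if_pos (by omega), if_pos (by omega)]
  · obtain ⟨s, hs⟩ := Nat.exists_eq_add_of_le' (not_lt.1 hlt)
    rw [hs, cyc_add_period, matrixOfForm, of_apply, hcyc ht, hcyc (by omega), if_pos (by omega)]
    split_ifs with h
    · rw [hB.1.isSymm.eq (ev t) (ev s), hB.2.2.1 s t (by omega) ht (by omega) (by omega),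
        monodromyAdj_ev, hB.1.isSymm.eq]
    · rfl

theorem agreesOnWindows_matrixOfForm (hn : 5 ≤ n) (hu : HasCirculantSupports u)
    (hB : B ∈ formsF u) : AgreesOnWindows (matrixOfForm B) B := by
  have hle : ∀ t b, b ≤ n - 3 →
      B (ev t) (ev (t + b)) = matrixOfForm B (cyc n t) (cyc n (t + b)) := fun t b hb => by
    have hform : Function.Periodic (fun t => B (ev t) (ev (t + b))) n := fun t => by
      simp only [add_right_comm t n, bilinForm_ev_add_period hn hu hB]
    have hmatrix : Function.Periodic (fun t => matrixOfForm B (cyc n t) (cyc n (t + b))) n :=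
      fun t => by simp only [add_right_comm t n, cyc_add_period]
    rw [← hform.map_mod_nat t, ← hmatrix.map_mod_nat t]
    exact bilinForm_ev_eq_matrixOfForm_of_lt (by omega) hB (Nat.mod_lt _ (by omega)) hb
  intro t s hs ht
  rcases le_total t s with h | h
  · obtain ⟨b, rfl⟩ := Nat.exists_eq_add_of_le h
    exact hle t b (by omega)
  · obtain ⟨b, rfl⟩ := Nat.exists_eq_add_of_le h
    rw [← hB.1.isSymm.eq, ← (matrixOfForm_isSymm hB.1.isSymm).apply]
    exact hle s b (by omega)

theorem formsF_subset_range_Lam (hn : 5 ≤ n) (hu : HasCirculantSupports u) :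
    formsF u ⊆ Set.range (Lam hn hu) := fun _ hB =>
  have hAB := agreesOnWindows_matrixOfForm hn hu hB
  ⟨⟨_, hAB.mem_spaceA (by omega) hu (matrixOfForm_isSymm hB.1.isSymm)⟩,
    Lam_eq_of_agreesOnWindows hn hu hAB⟩

theorem lt_of_mem_formsF_diff_formsP (hn : 5 ≤ n) (hu : HasCirculantSupports u)
    (hB : B ∈ formsF u \ formsP u) {t : ℕ} (ht : t < n) :
    B (monodromyAdj u (ev t)) (ev (t + 2)) < B (ev t) (ev (t + 2)) := by
  obtain ⟨A, rfl⟩ := formsF_subset_range_Lam hn hu hB.1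
  rw [Set.mem_sdiff, Lam_mem_formsP_iff] at hB
  refine (hB.1.2.2.2 t ht).lt_of_ne' fun h => hB.2 ?_
  exact mem_faceP_of_slack_eq_zero hn hu ((Lam_mem_formsF_iff hn hu A).1 hB.1)
    ((slack_eq_zero_iff hn hu A t).2 h)

end Lambda

end CircCop


theorem mainTheorem1 (n : ℕ) [NeZero n] (hn : 5 ≤ n) (u : Fin n → Fin n → ℝ)
    (hu : CircCop.HasCirculantSupports u) :
    -- `Λ` is injective and its image contains the set of forms, so that `Λ⁻¹` below is also the
    -- image under the inverse map
    (Function.Injective (CircCop.Lam hn hu) ∧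
      CircCop.formsF u ⊆ Set.range (CircCop.Lam hn hu)) ∧
    -- `F_u = Λ⁻¹[ℱ_u]`
    CircCop.faceF u = Subtype.val '' (CircCop.Lam hn hu ⁻¹' CircCop.formsF u) ∧
    -- `P_u = Λ⁻¹[𝒫_u]`
    CircCop.faceP u = Subtype.val '' (CircCop.Lam hn hu ⁻¹' CircCop.formsP u) ∧
    -- outside `𝒫_u` all inequalities are strict
    (∀ B ∈ CircCop.formsF u \ CircCop.formsP u, ∀ t < n,
      B (CircCop.ev t) (CircCop.ev (t + 2)) >
        B (CircCop.monodromyAdj u (CircCop.ev t)) (CircCop.ev (t + 2))) ∧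
    -- `F_u ∖ P_u` consists of exceptional matrices
    ∀ A ∈ CircCop.faceF u \ CircCop.faceP u, CircCop.IsExceptional A := by
  have hmem_spaceA : ∀ {A}, A ∈ CircCop.faceF u → A ∈ CircCop.spaceA u := fun hA =>
    ((CircCop.mem_faceF_iff (by omega) hu).1 hA).1
  refine ⟨⟨CircCop.Lam_injective hn hu, CircCop.formsF_subset_range_Lam hn hu⟩,
    Set.ext fun A => ?_, Set.ext fun A => ?_,
    fun B hB t ht => CircCop.lt_of_mem_formsF_diff_formsP hn hu hB ht,
    fun A hA => CircCop.isExceptional_of_mem_faceF_diff_faceP hn hu hA⟩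
  · constructor
    · exact fun hA => ⟨⟨A, hmem_spaceA hA⟩, (CircCop.Lam_mem_formsF_iff hn hu _).2 hA, rfl⟩
    · rintro ⟨A, hA, rfl⟩
      exact (CircCop.Lam_mem_formsF_iff hn hu A).1 hA
  · constructor
    · exact fun hA => ⟨⟨A, hmem_spaceA ((CircCop.mem_faceP_iff hn hu).1 hA).1⟩,
        (CircCop.Lam_mem_formsP_iff hn hu _).2 hA, rfl⟩
    · rintro ⟨A, hA, rfl⟩
      exact (CircCop.Lam_mem_formsP_iff hn hu A).1 hA
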